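/- Let $P_k=\mathbb F_2[x_1,\dots,x_k]$, graded by $\deg x_j=1$, with its usual action of the mod-2 Steenrod algebra $\mathcal A$: the Steenrod squares $Sq^i$ ($i\ge 0$) act by the linear maps determined by the Cartan formula $Sq^i(fg)=\sum_{a+b=i}Sq^a(f)Sq^b(g)$ together with $Sq^0=\mathrm{id}$, $Sq^1x_j=x_j^2$ and $Sq^ix_j=0$ for $i>1$. Let $\mathcal A^+$ be the augmentation ideal of $\mathcal A$, so that $\mathcal A^+P_k=\sum_{i>0}Sq^i(P_k)$; put $QP_k=P_k/\mathcal A^+P_k$, and let $(QP_k)_n$ be the subspace of $QP_k$ of the classes represented by homogeneous polynomials of degree $n$. A monomial $x_1^{a_1}\cdots x_k^{a_k}$ is a spike if every $a_j$ has the form $2^{e_j}-1$ with $e_j\ge 0$ an integer; let $N(k,n)$ be the number of spikes of degree $n$ in $P_k$. Let $k\ge 3$ and $d\ge 1$ be integers, and let $n=(k-1)(2^d-1)$, $p=\min\{k,d\}$, $q=\min\{k,d-1\}$. Then $$\dim_{\mathbb F_2} (QP_k)_n\ \ge\ N(k,n)+\sum_{t=2}^{p}\binom kt+(k-3)\binom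 k2\sum_{u=2}^{q}\binom ku ,$$ where a sum whose upper limit is less than $2$ is $0$. In particular (Mothebe's bound), $$\dim_{\mathbb F_2} (QP_k)_n\ \ge\ N(k,n)+\sum_{t=2}^{p}\binom kt .$$ -/

import Mathlib

open MvPolynomial

/-- The polynomial algebra `P_k = 𝔽₂[x_1, …, x_k]`. -/
abbrev PolyAlg (k : ℕ) : Type := MvPolynomial (Fin k) (ZMod 2)

/-- The total Steenrod square on `P_k`, with a bookkeeping variable `T`: the homomorphism of
algebras `P_k → P_k[T]` with `x_j ↦ x_j + x_j² T`. Being multiplicative is the Cartan formula. -/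
noncomputable def totalSq (k : ℕ) : PolyAlg k →ₐ[ZMod 2] Polynomial (PolyAlg k) :=
  aeval fun j => Polynomial.C (X j) + Polynomial.C (X j ^ 2) * Polynomial.X

/-- The Steenrod square `Sq^i : P_k → P_k`, the coefficient of `T^i` in the total square. -/
noncomputable def Sq (k i : ℕ) : PolyAlg k →ₗ[ZMod 2] PolyAlg k :=
  ((Polynomial.lcoeff (PolyAlg k) i).restrictScalars (ZMod 2)).comp (totalSq k).toLinearMap

/-- `Sq^i` is the coefficient of `T^i` in the total square. -/
theorem Sq_apply (k i : ℕ) (f : PolyAlg k) : Sq k i f = (totalSq k f).coeff i := rfl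

/-- The Cartan formula. -/
theorem Sq_mul (k i : ℕ) (f g : PolyAlg k) :
    Sq k i (f * g) = ∑ ab ∈ Finset.HasAntidiagonal.antidiagonal i, Sq k ab.1 f * Sq k ab.2 g := by
  simp only [Sq_apply, map_mul, Polynomial.coeff_mul]

/-- `Sq^0` is the identity. -/
theorem Sq_zero (k : ℕ) (f : PolyAlg k) : Sq k 0 f = f := by
  induction f using MvPolynomial.induction_on with
  | C a =>
    rw [Sq_apply, ← MvPolynomial.algebraMap_eq, AlgHom.commutes]
    simp [Polynomial.algebraMap_apply]
  | add f g hf hg => rw [map_add, hf, hg]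
  | mul_X f j hf =>
    rw [Sq_mul, Finset.HasAntidiagonal.antidiagonal_zero, Finset.sum_singleton, hf]
    simp [Sq_apply, totalSq]

/-- On the generators, `Sq^1 x_j = x_j²`. -/
theorem Sq_one_X (k : ℕ) (j : Fin k) : Sq k 1 (X j) = X j ^ 2 := by
  rw [Sq_apply, totalSq, aeval_X, Polynomial.coeff_add, Polynomial.coeff_C_succ,
    Polynomial.coeff_mul_X, Polynomial.coeff_C_zero, zero_add]

/-- On the generators, `Sq^i x_j = 0` for `i > 1`. -/
theorem Sq_X_of_one_lt (k i : ℕ) (hi : 1 < i) (j : Fin k) : Sq k i (X j) = 0 := by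
  obtain ⟨m, rfl⟩ := Nat.exists_eq_add_of_lt hi
  have h : 1 + m + 1 = (m + 1) + 1 := by ring
  rw [h]
  rw [Sq_apply, totalSq, aeval_X, Polynomial.coeff_add, Polynomial.coeff_C_succ,
    Polynomial.coeff_mul_X, Polynomial.coeff_C_succ, add_zero]

/-- The subspace `𝒜⁺P_k` of hit polynomials. The augmentation ideal `𝒜⁺` of the Steenrod algebra is
spanned by the nonempty composites of the squares `Sq^i` with `i > 0`, so `𝒜⁺P_k` is the sum of the
images of these squares. -/
noncomputable def hitSubspace (k : ℕ) : Submodule (ZMod 2) (PolyAlg k) :=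
  ⨆ i : ℕ, ⨆ _ : 0 < i, LinearMap.range (Sq k i)

/-- `QP_k = P_k / 𝒜⁺P_k`. -/
abbrev QP (k : ℕ) : Type := PolyAlg k ⧸ hitSubspace k

/-- `(QP_k)_n`: the subspace of `QP_k` of the classes represented by the homogeneous polynomials of
degree `n`. -/
noncomputable def QPdeg (k n : ℕ) : Submodule (ZMod 2) (QP k) :=
  (homogeneousSubmodule (Fin k) (ZMod 2) n).map (hitSubspace k).mkQ

/-- The monomial `x_1^{a_1} ⋯ x_k^{a_k}` (given by its exponents) is a spike if each exponent `a_j`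
has the form `2^e - 1` with `e ≥ 0`. -/
def IsSpike {k : ℕ} (a : Fin k →₀ ℕ) : Prop :=
  ∀ j, ∃ e : ℕ, a j = 2 ^ e - 1

/-- `N(k,n)`: the number of spikes of degree `n` in `P_k`. -/
noncomputable def numSpikes (k n : ℕ) : ℕ :=
  Set.ncard {a : Fin k →₀ ℕ | IsSpike a ∧ a.degree = n}

/-!
A linear substitution `L` of the variables commutes with the Steenrod squares, and the coefficient of
a spike in `Sq^i f` vanishes for `i > 0`. So for every spike `x^s` the functional
`f ↦ coeff s (L f)` kills the hit polynomials (`hitSubspace_le_ker_substCoeff`), and the dimension of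
`(QP_k)_n` is at least the number of functionals of this kind which are unitriangular on some family
of monomials of degree `n` (`card_le_finrank_QPdeg`). Three families are used.

* The coefficients of the spikes of degree `n`; there are `numSpikes k n` of them.
* For `S` with `2 ≤ |S| ≤ d` and a chosen `s₀ ∈ S`, restrict to the hyperplane `∑_{j ∈ S} x_j = 0` by
  eliminating `x_{s₀}`, then take the coefficient of `∏_{j ≠ s₀} x_j ^ (2 ^ d - 1)`. On a monomial
  whose `i`-th binary digits are all `1` except for the variable `z_i`, for `i < d`, the value is a
  product of determinants: it is `1` if all `z_i` lie in `S` and `0` otherwise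
  (`coeff_subst_gapRows`). This is the incidence matrix of inclusion between `{z_i}` and `S`.
* For `S` with `2 ≤ |S| ≤ d - 1`, do the same for the `d - 1` lowest rows of digits only. What is left
  of a monomial is some `x_c² ∏_{j ∈ B} x_j` with `|B| = k - 3`, on which a further substitution in
  the `k - 1` variables other than `x_{s₀}` is followed by the coefficient of some
  `x_c³ ∏ x_j`. There are `(k - 3) * k.choose 2` such functionals that are unitriangular on these
  monomials (`tailSystem`, `card_tails`).

The test monomials of the last two families are not spikes because `|S| ≥ 2`, and the second family
vanishes on the test monomials of the third, as the remaining factor `x_c²` leaves no squarefree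
term. So the whole evaluation matrix is unitriangular.
-/

/-! ### Spike coefficients of Steenrod squares -/

/-- If `a + i = 2 ^ e - 1` with `i > 0`, the binary digits of `i` are those missing from `a`, so
`a.choose i` is even. -/
theorem choose_even_of_add_eq_two_pow_sub_one (e : ℕ) :
    ∀ a i : ℕ, a + i = 2 ^ e - 1 → 0 < i → ((a.choose i : ℕ) : ZMod 2) = 0 := by
  induction e with
  | zero => intro a i h hi; simp at h; omega
  | succ e ih =>
    intro a i h hi
    have h2 : 0 < 2 ^ e := by positivity
    rw [pow_succ] at h
    have hmod := Choose.choose_modEq_choose_mod_mul_choose_div_nat (n := a) (k := i) (p := 2)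
    have hcast := (ZMod.natCast_eq_natCast_iff _ _ 2).2 hmod
    rw [hcast, Nat.cast_mul]
    rcases Nat.mod_two_eq_zero_or_one a with ha | ha
    · have : i % 2 = 1 := by omega
      rw [ha, this]; simp
    · rw [ih (a / 2) (i / 2) (by omega) (by omega), mul_zero]

theorem totalSq_X_pow (k : ℕ) (j : Fin k) (a : ℕ) :
    (totalSq k (X j)) ^ a = ∑ m ∈ Finset.range (a + 1),
      Polynomial.C (monomial (Finsupp.single j (a + m)) ((a.choose m : ℕ) : ZMod 2)) *
        Polynomial.X ^ m := by
  rw [totalSq, aeval_X, add_comm, add_pow]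
  refine Finset.sum_congr rfl fun m hm => ?_
  have hm' : m ≤ a := by simpa [Nat.lt_succ_iff] using hm
  have h1 : (monomial (Finsupp.single j (a + m)) ((a.choose m : ℕ) : ZMod 2) : PolyAlg k)
      = X j ^ (2 * m) * X j ^ (a - m) * ((a.choose m : ℕ) : PolyAlg k) := by
    have h2 : a + m = 2 * m + (a - m) := by omega
    rw [← pow_add, h2, X_pow_eq_monomial, ← map_natCast (C : ZMod 2 →+* PolyAlg k),
      mul_comm _ (C _), C_mul_monomial, mul_one]
  rw [h1]
  simp only [map_mul, map_pow, map_natCast]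
  ring

/-- A positive Steenrod square contributes nothing to the coefficient of a spike. -/
theorem coeff_Sq_of_isSpike {k i : ℕ} (hi : 0 < i) {s : Fin k →₀ ℕ} (hs : IsSpike s)
    (f : PolyAlg k) : coeff s (Sq k i f) = 0 := by
  classical
  induction f using MvPolynomial.induction_on' with
  | add p q hp hq => rw [map_add, coeff_add, hp, hq, add_zero]
  | monomial a r =>
    have hr : monomial a r = r • (monomial a (1 : ZMod 2) : PolyAlg k) := by
      rw [smul_monomial, smul_eq_mul, mul_one]
    rw [hr, map_smul, coeff_smul]
    have hprod : totalSq k (monomial a 1) = ∏ j, totalSq k (X j) ^ a j := by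
      rw [monomial_eq, C_1, one_mul, Finsupp.prod_fintype _ _ (by simp), map_prod]
      simp only [map_pow]
    have key : coeff s (Sq k i (monomial a 1)) = 0 := by
      rw [Sq_apply, hprod]
      simp_rw [totalSq_X_pow]
      rw [Finset.prod_univ_sum, Polynomial.finsetSum_coeff, coeff_sum]
      refine Finset.sum_eq_zero fun m hm => ?_
      rw [Finset.prod_mul_distrib, Finset.prod_pow_eq_pow_sum, ← map_prod, Polynomial.coeff_C_mul,
        Polynomial.coeff_X_pow, ← monomial_sum_prod]
      split_ifs with him
      swap
      · simp
      rw [mul_one, coeff_monomial]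
      split_ifs with hsum
      swap
      · rfl
      obtain ⟨j, -, hj⟩ : ∃ j ∈ Finset.univ, m j ≠ 0 := by
        by_contra! h
        rw [Finset.sum_eq_zero h] at him
        omega
      refine Finset.prod_eq_zero (Finset.mem_univ j) ?_
      obtain ⟨e, he⟩ := hs j
      refine choose_even_of_add_eq_two_pow_sub_one e _ _ ?_ (Nat.pos_of_ne_zero hj)
      rw [← he, ← hsum, Finsupp.finsetSum_apply, Finset.sum_eq_single j]
      · simp
      · intro b _ hb
        simp [hb]
      · simp
    rw [key, smul_zero]

/-- A linear substitution: an algebra endomorphism taking every variable to a linear form. -/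
def IsLinearSubst {k : ℕ} (L : PolyAlg k →ₐ[ZMod 2] PolyAlg k) : Prop :=
  ∀ j, (L (X j)).IsHomogeneous 1

theorem IsLinearSubst.isHomogeneous {k n : ℕ} {L : PolyAlg k →ₐ[ZMod 2] PolyAlg k}
    (hL : IsLinearSubst L) {f : PolyAlg k} (hf : f.IsHomogeneous n) : (L f).IsHomogeneous n := by
  have h := hf.aeval (fun j => L (X j)) hL
  rw [one_mul] at h
  convert h using 1
  rw [← comp_aeval_apply, aeval_X_left_apply]

theorem IsLinearSubst.comp {k : ℕ} {L M : PolyAlg k →ₐ[ZMod 2] PolyAlg k}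
    (hL : IsLinearSubst L) (hM : IsLinearSubst M) : IsLinearSubst (L.comp M) :=
  fun j => hL.isHomogeneous (hM j)

theorem isLinearSubst_id (k : ℕ) : IsLinearSubst (AlgHom.id (ZMod 2) (PolyAlg k)) :=
  fun j => isHomogeneous_X _ j

theorem totalSq_of_isHomogeneous_one {k : ℕ} {l : PolyAlg k} (hl : l.IsHomogeneous 1) :
    totalSq k l = Polynomial.C l + Polynomial.C (l ^ 2) * Polynomial.X := by
  have h : l ∈ Submodule.span (ZMod 2) (Set.range X) := by
    rw [← homogeneousSubmodule_one_eq_span_X]; exact hl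
  induction h using Submodule.span_induction with
  | mem x h => obtain ⟨j, rfl⟩ := h; rw [totalSq, aeval_X]
  | zero => simp
  | add x y hx hy h1 h2 =>
    rw [← homogeneousSubmodule_one_eq_span_X] at hx hy
    rw [map_add, h1 hx, h2 hy, CharTwo.add_sq]
    simp only [map_add]; ring
  | smul a x hx h1 =>
    rw [← homogeneousSubmodule_one_eq_span_X] at hx
    rw [map_smul, h1 hx, smul_pow]
    have : a ^ 2 = a := ZMod.pow_card a
    rw [this, smul_add, ← smul_mul_assoc, Polynomial.smul_C, Polynomial.smul_C]

/-- Linear substitutions commute with the Steenrod squares. -/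
theorem IsLinearSubst.Sq_comm {k : ℕ} {L : PolyAlg k →ₐ[ZMod 2] PolyAlg k}
    (hL : IsLinearSubst L) (i : ℕ) (f : PolyAlg k) : Sq k i (L f) = L (Sq k i f) := by
  have h : (totalSq k).comp L = (Polynomial.mapAlgHom L).comp (totalSq k) := by
    refine MvPolynomial.algHom_ext fun j => ?_
    rw [AlgHom.comp_apply, totalSq_of_isHomogeneous_one (hL j), AlgHom.comp_apply, totalSq, aeval_X]
    simp
  have h' := DFunLike.congr_fun h f
  simp only [AlgHom.comp_apply] at h'
  rw [Sq_apply, h', Sq_apply, Polynomial.coe_mapAlgHom, Polynomial.coeff_map]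
  rfl

/-- The functional reading off the coefficient at `s` after the substitution `L`. -/
noncomputable def substCoeff {k : ℕ} (L : PolyAlg k →ₐ[ZMod 2] PolyAlg k) (s : Fin k →₀ ℕ) :
    PolyAlg k →ₗ[ZMod 2] ZMod 2 :=
  (lcoeff (ZMod 2) s).comp L.toLinearMap

theorem substCoeff_apply {k : ℕ} (L : PolyAlg k →ₐ[ZMod 2] PolyAlg k) (s : Fin k →₀ ℕ)
    (f : PolyAlg k) : substCoeff L s f = coeff s (L f) := rfl

theorem hitSubspace_le_ker_substCoeff {k : ℕ} {L : PolyAlg k →ₐ[ZMod 2] PolyAlg k}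
    (hL : IsLinearSubst L) {s : Fin k →₀ ℕ} (hs : IsSpike s) :
    hitSubspace k ≤ LinearMap.ker (substCoeff L s) := by
  refine iSup₂_le fun i hi => ?_
  rintro _ ⟨f, rfl⟩
  rw [LinearMap.mem_ker, substCoeff_apply, ← hL.Sq_comm, coeff_Sq_of_isSpike hi hs]

/-! ### Dimension from a triangular family of functionals -/

/-- Functionals `φ i` and vectors `x i` whose evaluation matrix is unitriangular for the
preorder given by `rank` are linearly independent. -/
theorem linearIndependent_of_triangular {ι K V : Type*} [Fintype ι] [Field K] [AddCommGroup V]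
    [Module K V] (φ : ι → Module.Dual K V) (x : ι → V) (rank : ι → ℕ)
    (hdiag : ∀ i, φ i (x i) = 1)
    (hoff : ∀ i j, i ≠ j → rank i ≤ rank j → φ i (x j) = 0) : LinearIndependent K φ := by
  classical
  rw [Fintype.linearIndependent_iff]
  intro c hc
  by_contra! hne
  obtain ⟨i₀, hi₀⟩ := hne
  obtain ⟨j, hj, hmax⟩ := (Finset.univ.filter fun i => c i ≠ 0).exists_max_image rank
    ⟨i₀, by simpa using hi₀⟩
  have hj' : c j ≠ 0 := by simpa using hj
  have h := DFunLike.congr_fun hc (x j)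
  simp only [LinearMap.sum_apply, LinearMap.smul_apply, smul_eq_mul, LinearMap.zero_apply] at h
  rw [Finset.sum_eq_single j, hdiag, mul_one] at h
  · exact hj' h
  · intro i _ hij
    by_cases hi : c i = 0
    · rw [hi, zero_mul]
    · rw [hoff i j hij (hmax i (by simpa using hi)), mul_zero]
  · simp

instance QPdeg_finite (k n : ℕ) : Module.Finite (ZMod 2) (QPdeg k n) :=
  Module.Finite.iff_fg.2 ((homogeneousSubmodule_fg _ _ n).map _)

/-- The dimension of `(QP_k)_n` is at least the size of a unitriangular family of spike coefficients
after linear substitutions, evaluated on monomials of degree `n`. -/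
theorem card_le_finrank_QPdeg {k n : ℕ} {ι : Type*} [Fintype ι]
    (L : ι → PolyAlg k →ₐ[ZMod 2] PolyAlg k) (s a : ι → Fin k →₀ ℕ) (rank : ι → ℕ)
    (hL : ∀ i, IsLinearSubst (L i)) (hs : ∀ i, IsSpike (s i)) (ha : ∀ i, (a i).degree = n)
    (hdiag : ∀ i, coeff (s i) (L i (monomial (a i) 1)) = 1)
    (hoff : ∀ i j, i ≠ j → rank i ≤ rank j → coeff (s i) (L i (monomial (a j) 1)) = 0) :
    Fintype.card ι ≤ Module.finrank (ZMod 2) (QPdeg k n) := by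
  let φ : ι → Module.Dual (ZMod 2) (QPdeg k n) := fun i =>
    ((hitSubspace k).liftQ (substCoeff (L i) (s i))
      (hitSubspace_le_ker_substCoeff (hL i) (hs i))).comp (QPdeg k n).subtype
  let x : ι → QPdeg k n := fun i => ⟨(hitSubspace k).mkQ (monomial (a i) 1),
    Submodule.mem_map_of_mem (isHomogeneous_monomial 1 (ha i))⟩
  have h : LinearIndependent (ZMod 2) φ := linearIndependent_of_triangular φ x rank hdiag hoff
  rw [← Subspace.dual_finrank_eq]
  exact h.fintype_card_le_finrank

/-! ### Coefficients of products with squares -/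

/-- Over `𝔽₂` a square `g ^ 2` involves only monomials with even exponents. If `f` has the degree of
the squarefree monomial `x^u`, then parity and degree leave a single term in the coefficient of
`f * g ^ 2` at `x^u (x^E)²`. -/
theorem coeff_add_two_nsmul_mul_sq {k : ℕ} {f : PolyAlg k} (g : PolyAlg k) {u : Fin k →₀ ℕ}
    (E : Fin k →₀ ℕ) (hu : ∀ j, u j ≤ 1) (hf : f.IsHomogeneous u.degree) :
    coeff (u + 2 • E) (f * g ^ 2) = coeff u f * coeff E g := by
  classical
  rw [← expand_zmod, coeff_mul, Finset.sum_eq_single (u, 2 • E),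
    coeff_expand_smul 2 two_ne_zero]
  · rintro ⟨a, b⟩ hab hne
    rw [Finset.HasAntidiagonal.mem_antidiagonal] at hab
    have hab' : ∀ j, a j + b j = u j + 2 * E j := fun j => by
      simpa using DFunLike.congr_fun hab j
    dsimp only at hab ⊢
    by_cases hb : ∀ j, 2 ∣ b j
    · by_cases hd : a.degree = u.degree
      · exfalso
        have hle : ∀ j ∈ Finset.univ, u j ≤ a j := fun j _ => by
          have := hab' j; have := hu j; have := hb j; omega
        have hau : a = u := by
          rw [Finsupp.degree_eq_sum, Finsupp.degree_eq_sum] at hd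
          ext j
          exact ((Finset.sum_eq_sum_iff_of_le hle).1 hd.symm j (Finset.mem_univ j)).symm
        subst hau
        exact hne (by rw [add_left_cancel hab])
      · rw [hf.coeff_eq_zero hd, zero_mul]
    · push Not at hb
      obtain ⟨j, hj⟩ := hb
      rw [coeff_expand_of_not_dvd _ hj, mul_zero]
  · intro h
    simp at h

/-- A multiple of the square of a polynomial without constant term has no squarefree monomials. -/
theorem coeff_mul_sq_of_squarefree {k : ℕ} (f : PolyAlg k) {g : PolyAlg k} {u : Fin k →₀ ℕ}
    (hu : ∀ j, u j ≤ 1) (hg : coeff 0 g = 0) : coeff u (f * g ^ 2) = 0 := by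
  classical
  rw [← expand_zmod, coeff_mul]
  refine Finset.sum_eq_zero ?_
  rintro ⟨a, b⟩ hab
  rw [Finset.HasAntidiagonal.mem_antidiagonal] at hab
  dsimp only at hab ⊢
  by_cases hb : b = 0
  · rw [hb, coeff_expand_zero 2 two_ne_zero, hg, mul_zero]
  · obtain ⟨j, hj⟩ := Finsupp.ne_iff.1 hb
    have h1 : a j + b j = u j := by simpa using DFunLike.congr_fun hab j
    rw [Finsupp.zero_apply] at hj
    rw [coeff_expand_of_not_dvd (i := j), mul_zero]
    have := hu j
    omega

theorem IsLinearSubst.coeff_zero {k : ℕ} {L : PolyAlg k →ₐ[ZMod 2] PolyAlg k}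
    (hL : IsLinearSubst L) (j : Fin k) : coeff 0 (L (X j)) = 0 :=
  (hL j).coeff_eq_zero (by simp)

theorem monomial_eq_mul_X_sq {k : ℕ} {a : Fin k →₀ ℕ} {c : Fin k} (hc : 2 ≤ a c) :
    (monomial a 1 : PolyAlg k) = monomial (a - Finsupp.single c 2) 1 * X c ^ 2 := by
  rw [X_pow_eq_monomial, monomial_mul, one_mul, tsub_add_cancel_of_le]
  rwa [Finsupp.single_le_iff]

theorem IsLinearSubst.coeff_squarefree_of_two_le {k : ℕ} {L : PolyAlg k →ₐ[ZMod 2] PolyAlg k}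
    (hL : IsLinearSubst L) {u a : Fin k →₀ ℕ} {c : Fin k} (hu : ∀ j, u j ≤ 1) (hc : 2 ≤ a c) :
    coeff u (L (monomial a 1)) = 0 := by
  rw [monomial_eq_mul_X_sq hc, map_mul, map_pow]
  exact coeff_mul_sq_of_squarefree _ hu (hL.coeff_zero c)

/-! ### Exponents whose lowest binary digits have one gap in each row -/

/-- The exponent of `∏_{j ≠ z} x_j`. -/
noncomputable def allBut {k : ℕ} (z : Fin k) : Fin k →₀ ℕ :=
  Finsupp.equivFunOnFinite.symm fun j => if j = z then 0 else 1

theorem allBut_apply {k : ℕ} (z j : Fin k) : allBut z j = if j = z then 0 else 1 := rfl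

theorem allBut_le_one {k : ℕ} (z j : Fin k) : allBut z j ≤ 1 := by
  rw [allBut_apply]; split_ifs <;> omega

theorem degree_allBut {k : ℕ} (z : Fin k) : (allBut z).degree = k - 1 := by
  rw [Finsupp.degree_eq_sum]
  simp [allBut_apply, Finset.sum_ite, Finset.filter_ne']

/-- The exponent `∑_i 2^i • allBut z_i + 2^r • a`, where `z_0, …, z_{r-1}` are the entries of the
list. -/
noncomputable def gapRows {k : ℕ} : List (Fin k) → (Fin k →₀ ℕ) → Fin k →₀ ℕ
  | [], a => a
  | z :: l, a => allBut z + 2 • gapRows l a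

theorem degree_gapRows {k : ℕ} (l : List (Fin k)) (a : Fin k →₀ ℕ) :
    (gapRows l a).degree + (k - 1) = 2 ^ l.length * (a.degree + (k - 1)) := by
  induction l with
  | nil => simp [gapRows]
  | cons z l ih =>
    rw [gapRows, map_add, map_nsmul, degree_allBut, List.length_cons, pow_succ, smul_eq_mul]
    linarith

theorem eq_of_gapRows_apply_eq_zero {k : ℕ} {l : List (Fin k)} {a : Fin k →₀ ℕ} {z : Fin k}
    (h : gapRows l a z = 0) : ∀ y ∈ l, y = z := by
  induction l with
  | nil => simp
  | cons y l ih =>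
    have h' : allBut y z + 2 * gapRows l a z = 0 := by simpa [gapRows] using h
    rw [allBut_apply] at h'
    intro w hw
    rcases List.mem_cons.1 hw with rfl | hw
    · by_contra hne
      rw [if_neg (Ne.symm hne)] at h'
      omega
    · exact ih (by omega) w hw

/-- In a spike a binary digit `0` is followed only by zeros, so all gaps lie in one column. -/
theorem card_toFinset_le_one_of_isSpike_gapRows {k : ℕ} {l : List (Fin k)} {a : Fin k →₀ ℕ}
    (h : IsSpike (gapRows l a)) : l.toFinset.card ≤ 1 := by
  cases l with
  | nil => simp
  | cons z l =>
    obtain ⟨e, he⟩ := h z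
    have h' : allBut z z + 2 * gapRows l a z = 2 ^ e - 1 := by simpa [gapRows] using he
    rw [allBut_apply, if_pos rfl] at h'
    have h0 : gapRows l a z = 0 := by
      cases e with
      | zero => simpa using h'
      | succ e => rw [pow_succ] at h'; have : 0 < 2 ^ e := by positivity
                  omega
    have hz := eq_of_gapRows_apply_eq_zero h0
    rw [Finset.card_le_one]
    intro x hx y hy
    rw [List.mem_toFinset, List.mem_cons] at hx hy
    rw [hx.elim id (hz x), hy.elim id (hz y)]

theorem isSpike_gapRows_replicate {k : ℕ} {s₀ : Fin k} {E : Fin k →₀ ℕ} (hE : IsSpike E)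
    (h0 : E s₀ = 0) (r : ℕ) :
    IsSpike (gapRows (List.replicate r s₀) E) ∧ gapRows (List.replicate r s₀) E s₀ = 0 := by
  induction r with
  | zero => exact ⟨hE, h0⟩
  | succ r ih =>
    rw [List.replicate_succ]
    have happ : ∀ j, gapRows (s₀ :: List.replicate r s₀) E j
        = allBut s₀ j + 2 * gapRows (List.replicate r s₀) E j := fun j => by simp [gapRows]
    have hs : gapRows (s₀ :: List.replicate r s₀) E s₀ = 0 := by
      rw [happ, ih.2, allBut_apply, if_pos rfl]
    refine ⟨fun j => ?_, hs⟩
    by_cases hj : j = s₀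
    · exact ⟨0, by rw [hj, hs]; rfl⟩
    · obtain ⟨e, he⟩ := ih.1 j
      refine ⟨e + 1, ?_⟩
      rw [happ, he, allBut_apply, if_neg hj, pow_succ]
      have : 0 < 2 ^ e := by positivity
      omega

/-- Kameko's halving of exponents, applied once for each entry of the list: if `L` sends
`∏_{j ≠ z} x_j` to a polynomial whose coefficient at `∏_{j ≠ s₀} x_j` is the indicator of `z ∈ S`,
then the lowest rows of digits contribute the indicator of all gaps lying in `S`. -/
theorem coeff_subst_gapRows {k : ℕ} {L : PolyAlg k →ₐ[ZMod 2] PolyAlg k} (hL : IsLinearSubst L)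
    {S : Finset (Fin k)} {s₀ : Fin k}
    (hS : ∀ z, coeff (allBut s₀) (L (monomial (allBut z) 1)) = if z ∈ S then 1 else 0)
    (l : List (Fin k)) (E a : Fin k →₀ ℕ) :
    coeff (gapRows (List.replicate l.length s₀) E) (L (monomial (gapRows l a) 1)) =
      if l.toFinset ⊆ S then coeff E (L (monomial a 1)) else 0 := by
  induction l with
  | nil => simp [gapRows]
  | cons z l ih =>
    have hm : (monomial (gapRows (z :: l) a) 1 : PolyAlg k)
        = monomial (allBut z) 1 * monomial (gapRows l a) 1 ^ 2 := by
      rw [gapRows, monomial_pow, monomial_mul, one_pow, one_mul]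
    rw [List.length_cons, List.replicate_succ, hm, map_mul, map_pow, gapRows,
      coeff_add_two_nsmul_mul_sq _ _ (allBut_le_one s₀), hS, ih]
    · simp only [List.toFinset_cons, Finset.insert_subset_iff]
      split_ifs <;> simp_all
    · rw [degree_allBut, ← degree_allBut z]
      exact hL.isHomogeneous (isHomogeneous_monomial 1 rfl)

/-! ### Projection to a hyperplane -/

/-- The substitution `x_{s₀} ↦ ∑_{j ∈ S, j ≠ s₀} x_j` fixing the other variables: for `s₀ ∈ S`, the
restriction of polynomials to the hyperplane `∑_{j ∈ S} x_j = 0`. -/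
noncomputable def hyperplaneSubst {k : ℕ} (S : Finset (Fin k)) (s₀ : Fin k) :
    PolyAlg k →ₐ[ZMod 2] PolyAlg k :=
  aeval fun j => if j = s₀ then ∑ i ∈ S.erase s₀, X i else X j

theorem isLinearSubst_hyperplaneSubst {k : ℕ} (S : Finset (Fin k)) (s₀ : Fin k) :
    IsLinearSubst (hyperplaneSubst S s₀) := by
  intro j
  rw [hyperplaneSubst, aeval_X]
  split_ifs
  · exact IsHomogeneous.sum _ _ _ fun i _ => isHomogeneous_X _ i
  · exact isHomogeneous_X _ j

theorem hyperplaneSubst_monomial {k : ℕ} (S : Finset (Fin k)) {s₀ : Fin k} {a : Fin k →₀ ℕ}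
    (ha : a s₀ = 0) : hyperplaneSubst S s₀ (monomial a 1) = monomial a 1 := by
  conv_rhs => rw [monomial_eq]
  rw [hyperplaneSubst, aeval_monomial, map_one, C_1]
  congr 1
  refine Finsupp.prod_congr fun j hj => ?_
  rw [if_neg]
  rintro rfl
  exact (Finsupp.mem_support_iff.1 hj) ha

/-- The coefficient of `∏_{j ≠ s₀} x_j` in the image of `∏_{j ≠ z} x_j` is the determinant of linear
forms on the hyperplane `∑_{j ∈ S} x_j = 0`, that is, the `z`-th coordinate of its normal vector. -/
theorem coeff_comp_hyperplaneSubst_allBut {k : ℕ} {T : PolyAlg k →ₐ[ZMod 2] PolyAlg k}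
    (hT : IsLinearSubst T) {S : Finset (Fin k)} {s₀ : Fin k} (hs₀ : s₀ ∈ S)
    (hdet : coeff (allBut s₀) (T (monomial (allBut s₀) 1)) = 1) (z : Fin k) :
    coeff (allBut s₀) ((T.comp (hyperplaneSubst S s₀)) (monomial (allBut z) 1))
      = if z ∈ S then 1 else 0 := by
  rw [AlgHom.comp_apply]
  by_cases hz : z = s₀
  · subst hz
    rw [hyperplaneSubst_monomial _ (by rw [allBut_apply, if_pos rfl]), hdet, if_pos hs₀]
  · set w : Fin k →₀ ℕ := allBut z - Finsupp.single s₀ 1 with hw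
    have hwapp : ∀ j, w j = if j = z ∨ j = s₀ then 0 else 1 := fun j => by
      rw [hw, Finsupp.tsub_apply, allBut_apply, Finsupp.single_apply]
      grind
    have hm : (monomial (allBut z) 1 : PolyAlg k) = X s₀ * monomial w 1 := by
      have hadd : allBut z = Finsupp.single s₀ 1 + w := by
        ext j
        rw [Finsupp.add_apply, hwapp, allBut_apply, Finsupp.single_apply]
        grind
      rw [X, monomial_mul, one_mul, hadd]
    have hX : hyperplaneSubst S s₀ (X s₀) = ∑ i ∈ S.erase s₀, X i := by
      rw [hyperplaneSubst, aeval_X, if_pos rfl]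
    rw [hm, map_mul, hX, hyperplaneSubst_monomial _ (by rw [hwapp, if_pos (Or.inr rfl)]),
      Finset.sum_mul, map_sum, coeff_sum]
    have hterm : ∀ i ∈ S.erase s₀,
        coeff (allBut s₀) (T (X i * monomial w 1)) = if i = z then 1 else 0 := by
      intro i hi
      have hi0 : i ≠ s₀ := Finset.ne_of_mem_erase hi
      rw [X, monomial_mul, one_mul]
      split_ifs with hiz
      · have hadd : Finsupp.single i 1 + w = allBut s₀ := by
          ext j
          rw [Finsupp.add_apply, hwapp, allBut_apply, Finsupp.single_apply]
          grind
        rw [hadd, hdet]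
      · refine hT.coeff_squarefree_of_two_le (c := i) (allBut_le_one s₀) ?_
        rw [Finsupp.add_apply, hwapp, Finsupp.single_apply, if_pos rfl]
        grind
    rw [Finset.sum_congr rfl hterm, Finset.sum_ite_eq']
    simp [hz]

/-! ### Transvections -/

/-- The substitution `x_c ↦ x_c + x_b` fixing the other variables. -/
noncomputable def transvection {k : ℕ} (c b : Fin k) : PolyAlg k →ₐ[ZMod 2] PolyAlg k :=
  aeval fun j => if j = c then X c + X b else X j

theorem isLinearSubst_transvection {k : ℕ} (c b : Fin k) : IsLinearSubst (transvection c b) := by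
  intro j
  rw [transvection, aeval_X]
  split_ifs
  · exact (isHomogeneous_X _ c).add (isHomogeneous_X _ b)
  · exact isHomogeneous_X _ j

theorem transvection_monomial {k : ℕ} (c b : Fin k) (a : Fin k →₀ ℕ) :
    transvection c b (monomial a 1) = (X c + X b) ^ a c * monomial (a.erase c) 1 := by
  have h : (monomial a 1 : PolyAlg k) = X c ^ a c * monomial (a.erase c) 1 := by
    rw [X_pow_eq_monomial, monomial_mul, one_mul, Finsupp.single_add_erase]
  have hfix : transvection c b (monomial (a.erase c) 1) = monomial (a.erase c) 1 := by
    conv_rhs => rw [monomial_eq]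
    rw [transvection, aeval_monomial, map_one, C_1]
    congr 1
    refine Finsupp.prod_congr fun j hj => ?_
    rw [if_neg]
    rintro rfl
    simp at hj
  rw [h, map_mul, hfix, map_pow]
  congr 2
  rw [transvection, aeval_X, if_pos rfl]

/-- Only the powers of `x_b` in the expansion of `(x_c + x_b) ^ m` survive at an exponent that does
not involve `x_c`. -/
theorem coeff_X_add_X_pow_mul_monomial {k : ℕ} {c b : Fin k} {E : Fin k →₀ ℕ} (hE : E c = 0)
    (m : ℕ) (w : Fin k →₀ ℕ) :
    coeff E ((X c + X b) ^ m * monomial w (1 : ZMod 2)) =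
      if w + Finsupp.single b m = E then 1 else 0 := by
  classical
  induction m generalizing w with
  | zero => simp [coeff_monomial]
  | succ m ih =>
    have h : ((X c + X b) ^ (m + 1) * monomial w 1 : PolyAlg k)
        = X c * ((X c + X b) ^ m * monomial w 1)
          + (X c + X b) ^ m * monomial (w + Finsupp.single b 1) 1 := by
      have : (monomial (w + Finsupp.single b 1) 1 : PolyAlg k) = monomial w 1 * X b := by
        rw [X, monomial_mul, one_mul]
      rw [this]; ring
    rw [h, coeff_add, coeff_X_mul', if_neg (by simpa using hE), zero_add, ih, add_assoc,
      ← Finsupp.single_add, add_comm 1 m]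

theorem coeff_transvection {k : ℕ} {c b : Fin k} {E : Fin k →₀ ℕ} (hE : E c = 0)
    (a : Fin k →₀ ℕ) :
    coeff E (transvection c b (monomial a 1)) =
      if a.erase c + Finsupp.single b (a c) = E then 1 else 0 := by
  rw [transvection_monomial, coeff_X_add_X_pow_mul_monomial hE]

theorem coeff_transvection_allBut {k : ℕ} {c b s₀ : Fin k} (hcb : c ≠ b) (hc : c ≠ s₀) :
    coeff (allBut s₀) (transvection c b (monomial (allBut s₀) 1)) = 1 := by
  classical
  have h1 : allBut s₀ c = 1 := by rw [allBut_apply, if_neg hc]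
  have h2 : (X c * monomial ((allBut s₀).erase c) 1 : PolyAlg k) = monomial (allBut s₀) 1 := by
    have := Finsupp.single_add_erase c (allBut s₀)
    rw [h1] at this
    rw [X, monomial_mul, one_mul, this]
  rw [transvection_monomial, h1, pow_one, add_mul, h2, X, monomial_mul, coeff_add, coeff_monomial,
    coeff_monomial, if_pos rfl, if_neg, add_zero]
  intro h
  have := DFunLike.congr_fun h c
  rw [h1] at this
  simp [hcb.symm] at this

/-! ### Functionals on the monomials `x_c² ∏_{j ∈ B} x_j` with `|B| = k - 3` -/

/-- The exponent of `x_c ^ m ∏_{j ∉ R, j ≠ c} x_j`. -/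
noncomputable def peak {k : ℕ} (m : ℕ) (c : Fin k) (R : Finset (Fin k)) : Fin k →₀ ℕ :=
  Finsupp.equivFunOnFinite.symm fun j => if j = c then m else if j ∈ R then 0 else 1

theorem peak_apply {k : ℕ} (m : ℕ) (c : Fin k) (R : Finset (Fin k)) (j : Fin k) :
    peak m c R j = if j = c then m else if j ∈ R then 0 else 1 := rfl

theorem degree_peak {k : ℕ} (m : ℕ) {c : Fin k} {R : Finset (Fin k)} (hc : c ∉ R) :
    (peak m c R).degree + R.card + 1 = m + k := by
  have h : ∀ j, peak m c R j + ((if j ∈ R then 1 else 0) + (if j = c then 1 else 0))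
      = 1 + (if j = c then m else 0) := fun j => by
    have hne : j ∈ R → j ≠ c := fun hj hjc => hc (hjc ▸ hj)
    rw [peak_apply]
    grind
  have h' := Finset.sum_congr (rfl : (Finset.univ : Finset (Fin k)) = Finset.univ)
    fun j _ => h j
  rw [Finset.sum_add_distrib, Finset.sum_add_distrib, Finset.sum_add_distrib] at h'
  rw [Finsupp.degree_eq_sum]
  simp at h'
  omega

theorem isSpike_peak_three {k : ℕ} (c : Fin k) (R : Finset (Fin k)) : IsSpike (peak 3 c R) := by
  intro j
  rw [peak_apply]
  split_ifs
  · exact ⟨2, rfl⟩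
  · exact ⟨0, rfl⟩
  · exact ⟨1, rfl⟩

/-- A unitriangular family for the leading rows of binary digits: substitutions `T i` with spikes
`E i`, and monomials `A i` of degree `k - 1` divisible by some `x_c²`, none of which involves
`x_{s₀}`. The condition `det` says that `T i` has determinant `1` in the variables other than
`x_{s₀}`. -/
structure TailSystem {k : ℕ} (s₀ : Fin k) (ι : Type) where
  /-- the substitutions -/
  T : ι → PolyAlg k →ₐ[ZMod 2] PolyAlg k
  /-- the spikes at which coefficients are read off -/
  E : ι → Fin k →₀ ℕ
  /-- the test monomials -/
  A : ι → Fin k →₀ ℕ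
  /-- the rank for which the evaluation matrix is unitriangular -/
  rank : ι → ℕ
  isLinearSubst : ∀ i, IsLinearSubst (T i)
  det : ∀ i, coeff (allBut s₀) (T i (monomial (allBut s₀) 1)) = 1
  isSpike : ∀ i, IsSpike (E i)
  E_apply : ∀ i, E i s₀ = 0
  A_apply : ∀ i, A i s₀ = 0
  degree_A : ∀ i, (A i).degree = k - 1
  two_le : ∀ i, ∃ c, 2 ≤ A i c
  rank_le : ∀ i, rank i ≤ 1
  diag : ∀ i, coeff (E i) (T i (monomial (A i) 1)) = 1
  off : ∀ i j, i ≠ j → rank i ≤ rank j → coeff (E i) (T i (monomial (A j) 1)) = 0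

/-- The pairs `(c, P)` standing for the spikes `x_c³ ∏_{j ∉ P, j ≠ c, s₀} x_j`. -/
def spikeTails {k : ℕ} (s₀ : Fin k) : Finset (Σ _ : Fin k, Finset (Fin k)) :=
  (Finset.univ.erase s₀).sigma fun c => ((Finset.univ.erase s₀).erase c).powersetCard 2

/-- The pairs `(a, c)` standing for the monomials `x_c² ∏_{j ≠ a, c, s₀} x_j`. For each `a` these
have the hit sum `Sq¹ (∏_{j ≠ a, s₀} x_j)`, and so one value `c = b a` is left out. -/
def squareTails {k : ℕ} (s₀ : Fin k) (b : Fin k → Fin k) : Finset (Σ _ : Fin k, Fin k) :=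
  (Finset.univ.erase s₀).sigma fun a => ((Finset.univ.erase s₀).erase a).erase (b a)

theorem mem_spikeTails {k : ℕ} {s₀ : Fin k} {x : Σ _ : Fin k, Finset (Fin k)} :
    x ∈ spikeTails s₀ ↔ x.1 ≠ s₀ ∧ x.1 ∉ x.2 ∧ s₀ ∉ x.2 ∧ x.2.card = 2 := by
  rw [spikeTails, Finset.mem_sigma, Finset.mem_powersetCard, Finset.subset_erase,
    Finset.subset_erase]
  simp
  tauto

theorem mem_squareTails {k : ℕ} {s₀ : Fin k} {b : Fin k → Fin k} {x : Σ _ : Fin k, Fin k} :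
    x ∈ squareTails s₀ b ↔ x.1 ≠ s₀ ∧ x.2 ≠ b x.1 ∧ x.2 ≠ x.1 ∧ x.2 ≠ s₀ := by
  simp [squareTails]

theorem card_tails {k : ℕ} (hk : 3 ≤ k) {s₀ : Fin k} {b : Fin k → Fin k}
    (hb : ∀ a, b a ≠ s₀ ∧ b a ≠ a) :
    (spikeTails s₀).card + (squareTails s₀ b).card = (k - 3) * k.choose 2 := by
  have h1 : (spikeTails s₀).card = (k - 1) * (k - 2).choose 2 := by
    rw [spikeTails, Finset.card_sigma, Finset.sum_const_nat (m := (k - 2).choose 2)]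
    · simp
    · intro c hc
      rw [Finset.card_powersetCard, Finset.card_erase_of_mem hc]
      simp [Nat.sub_sub]
  have h2 : (squareTails s₀ b).card = (k - 1) * (k - 3) := by
    rw [squareTails, Finset.card_sigma, Finset.sum_const_nat (m := k - 3)]
    · simp
    · intro c hc
      rw [Finset.card_erase_of_mem, Finset.card_erase_of_mem hc]
      · simp [Nat.sub_sub]
      · simp [hb c]
  obtain ⟨m, rfl⟩ := Nat.exists_eq_add_of_le' hk
  rw [h1, h2]
  have e1 : m + 3 - 1 = m + 2 := by omega
  have e2 : m + 3 - 2 = m + 1 := by omega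
  have e3 : m + 3 - 3 = m := by omega
  rw [e1, e2, e3]
  have h4 : (m + 1).choose 2 * 2 = (m + 1) * m := by
    rw [Nat.choose_two_right, Nat.div_mul_cancel]
    · simp
    · exact (Nat.even_mul_pred_self (m + 1)).two_dvd
  have h5 : (m + 3).choose 2 * 2 = (m + 3) * (m + 2) := by
    rw [Nat.choose_two_right, Nat.div_mul_cancel]
    · simp
    · exact (Nat.even_mul_pred_self (m + 3)).two_dvd
  nlinarith

theorem peak_three_injective {k : ℕ} {c c' : Fin k} {R R' : Finset (Fin k)} (hc : c ∉ R)
    (hc' : c' ∉ R') (h : peak 3 c R = peak 3 c' R') : c = c' ∧ R = R' := by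
  have h' : ∀ j, peak 3 c R j = peak 3 c' R' j := fun j => by rw [h]
  simp only [peak_apply] at h'
  have hcc : c = c' := by
    have := h' c
    grind
  subst hcc
  refine ⟨rfl, ?_⟩
  ext j
  have := h' j
  grind

theorem erase_add_single_peak_two_eq_iff {k : ℕ} {s₀ a c a' c' : Fin k} {b : Fin k → Fin k}
    (hb : ∀ a, b a ≠ s₀ ∧ b a ≠ a) (h : (⟨a, c⟩ : Σ _ : Fin k, Fin k) ∈ squareTails s₀ b)
    (h' : (⟨a', c'⟩ : Σ _ : Fin k, Fin k) ∈ squareTails s₀ b) :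
    (peak 2 c' {s₀, a'}).erase c + Finsupp.single (b a) (peak 2 c' {s₀, a'} c)
      = peak 3 (b a) {s₀, a, c} ↔ a = a' ∧ c = c' := by
  rw [mem_squareTails] at h h'
  obtain ⟨h1, h2, h3, h4⟩ := h
  obtain ⟨h1', h2', h3', h4'⟩ := h'
  dsimp only at *
  have hba := hb a
  constructor
  · intro heq
    have heq' : ∀ j, (if j = c then 0 else peak 2 c' {s₀, a'} j)
        + (if b a = j then peak 2 c' {s₀, a'} c else 0) = peak 3 (b a) {s₀, a, c} j := fun j => by
      rw [← heq, Finsupp.add_apply, Finsupp.erase_apply, Finsupp.single_apply]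
    simp only [peak_apply, Finset.mem_insert, Finset.mem_singleton] at heq'
    have haa : a = a' := by
      have := heq' a
      grind
    subst haa
    refine ⟨rfl, ?_⟩
    have := heq' (b a)
    grind
  · rintro ⟨rfl, rfl⟩
    ext j
    rw [Finsupp.add_apply, Finsupp.erase_apply, Finsupp.single_apply]
    simp only [peak_apply, Finset.mem_insert, Finset.mem_singleton]
    grind

/-- The spikes `x_c³ ∏ x_j` are detected by their own coefficients. A monomial `x_c² ∏ x_j` is
detected by the substitution `x_c ↦ x_c + x_b`, which creates the spike `x_b³ ∏ x_j`. -/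
noncomputable def tailSystem {k : ℕ} (s₀ : Fin k) {b : Fin k → Fin k}
    (hb : ∀ a, b a ≠ s₀ ∧ b a ≠ a) : TailSystem s₀ (spikeTails s₀ ⊕ squareTails s₀ b) where
  T := Sum.elim (fun _ => AlgHom.id _ _) fun x => transvection x.1.2 (b x.1.1)
  E := Sum.elim (fun x => peak 3 x.1.1 (insert s₀ x.1.2))
    fun x => peak 3 (b x.1.1) {s₀, x.1.1, x.1.2}
  A := Sum.elim (fun x => peak 3 x.1.1 (insert s₀ x.1.2)) fun x => peak 2 x.1.2 {s₀, x.1.1}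
  rank := Sum.elim (fun _ => 0) fun _ => 1
  isLinearSubst := by
    rintro (x | x)
    · exact isLinearSubst_id k
    · exact isLinearSubst_transvection _ _
  det := by
    rintro (x | ⟨x, hx⟩)
    · simp
    · rw [mem_squareTails] at hx
      exact coeff_transvection_allBut hx.2.1 hx.2.2.2
  isSpike := by
    rintro (x | x) <;> exact isSpike_peak_three _ _
  E_apply := by
    rintro (⟨x, hx⟩ | ⟨x, hx⟩)
    · rw [mem_spikeTails] at hx
      simp [peak_apply, hx.1.symm]
    · simp [peak_apply, (hb x.1).1.symm]
  A_apply := by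
    rintro (⟨x, hx⟩ | ⟨x, hx⟩)
    · rw [mem_spikeTails] at hx
      simp [peak_apply, hx.1.symm]
    · rw [mem_squareTails] at hx
      simp [peak_apply, hx.2.2.2.symm]
  degree_A := by
    rintro (⟨x, hx⟩ | ⟨x, hx⟩)
    · rw [mem_spikeTails] at hx
      have h := degree_peak 3 (c := x.1) (R := insert s₀ x.2) (by simp [hx.1, hx.2.1])
      rw [Finset.card_insert_of_notMem hx.2.2.1, hx.2.2.2] at h
      simp only [Sum.elim_inl]
      omega
    · rw [mem_squareTails] at hx
      have h := degree_peak 2 (c := x.2) (R := {s₀, x.1}) (by simp [hx.2.2])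
      rw [Finset.card_pair hx.1.symm] at h
      simp only [Sum.elim_inr]
      omega
  two_le := by
    rintro (x | x)
    · exact ⟨x.1.1, by simp [peak_apply]⟩
    · exact ⟨x.1.2, by simp [peak_apply]⟩
  rank_le := by
    rintro (x | x) <;> simp
  diag := by
    rintro (x | ⟨x, hx⟩)
    · simp
    · simp only [Sum.elim_inr]
      rw [coeff_transvection, if_pos]
      · exact (erase_add_single_peak_two_eq_iff hb hx hx).2 ⟨rfl, rfl⟩
      · rw [mem_squareTails] at hx
        simp [peak_apply, hx.2.1]
  off := by
    classical
    rintro (⟨x, hx⟩ | ⟨x, hx⟩) (⟨y, hy⟩ | ⟨y, hy⟩) hne hrank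
    · simp only [Sum.elim_inl, AlgHom.id_apply]
      rw [coeff_monomial, if_neg]
      intro h
      rw [mem_spikeTails] at hx hy
      obtain ⟨h1, h2⟩ := peak_three_injective (by simp [hy.1, hy.2.1]) (by simp [hx.1, hx.2.1]) h
      have h3 : y.2 = x.2 := by
        rw [← Finset.erase_insert hy.2.2.1, h2, Finset.erase_insert hx.2.2.1]
      apply hne
      congr 2
      exact (Sigma.ext h1 (heq_of_eq h3)).symm
    · simp only [Sum.elim_inl, Sum.elim_inr, AlgHom.id_apply]
      rw [coeff_monomial, if_neg]
      intro h
      have := DFunLike.congr_fun h x.1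
      simp only [peak_apply] at this
      grind
    · simp at hrank
    · simp only [Sum.elim_inr]
      rw [coeff_transvection, if_neg]
      · intro h
        obtain ⟨h1, h2⟩ := (erase_add_single_peak_two_eq_iff hb hx hy).1 h
        apply hne
        congr 2
        exact Sigma.ext h1 (heq_of_eq h2)
      · rw [mem_squareTails] at hx
        simp [peak_apply, hx.2.1]

/-! ### The lower bound -/

theorem gapRows_append {k : ℕ} (l l' : List (Fin k)) (a : Fin k →₀ ℕ) :
    gapRows (l ++ l') a = gapRows l (gapRows l' a) := by
  induction l with
  | nil => rfl
  | cons z l ih => rw [List.cons_append, gapRows, gapRows, ih]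

theorem exists_list_of_card_le {α : Type*} [DecidableEq α] {S : Finset α} (hS : S.Nonempty)
    {r : ℕ} (hr : S.card ≤ r) : ∃ l : List α, l.length = r ∧ l.toFinset = S := by
  obtain ⟨s, hs⟩ := hS
  refine ⟨S.toList ++ List.replicate (r - S.card) s, ?_, ?_⟩
  · simp; omega
  · ext x
    simp only [List.toFinset_append, Finset.toList_toFinset, Finset.mem_union, List.mem_toFinset,
      List.mem_replicate]
    constructor
    · rintro (h | ⟨-, rfl⟩)
      · exact h
      · exact hs
    · exact Or.inl

theorem card_subtype_card_mem_Icc (k p : ℕ) :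
    Fintype.card {S : Finset (Fin k) // 2 ≤ S.card ∧ S.card ≤ p}
      = ∑ t ∈ Finset.Icc 2 p, k.choose t := by
  rw [Fintype.card_subtype, Finset.card_eq_sum_card_fiberwise (f := Finset.card)
    (t := Finset.Icc 2 p)]
  · refine Finset.sum_congr rfl fun t ht => ?_
    rw [Finset.mem_Icc] at ht
    have h : Finset.filter (fun S => S.card = t)
        (Finset.univ.filter fun S : Finset (Fin k) => 2 ≤ S.card ∧ S.card ≤ p)
        = Finset.powersetCard t Finset.univ := by
      ext S
      simp only [Finset.mem_filter, Finset.mem_univ, true_and, Finset.mem_powersetCard,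
        Finset.subset_univ]
      omega
    rw [h, Finset.card_powersetCard, Finset.card_univ, Fintype.card_fin]
  · intro S hS
    simpa using hS

theorem coeff_comp_hyperplaneSubst_gapRows {k : ℕ} {T : PolyAlg k →ₐ[ZMod 2] PolyAlg k}
    (hT : IsLinearSubst T) {S : Finset (Fin k)} {s₀ : Fin k} (hs₀ : s₀ ∈ S)
    (hdet : coeff (allBut s₀) (T (monomial (allBut s₀) 1)) = 1) {r : ℕ} {l : List (Fin k)}
    (hl : l.length = r) (E a : Fin k →₀ ℕ) :
    coeff (gapRows (List.replicate r s₀) E)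
        ((T.comp (hyperplaneSubst S s₀)) (monomial (gapRows l a) 1)) =
      if l.toFinset ⊆ S then coeff E ((T.comp (hyperplaneSubst S s₀)) (monomial a 1)) else 0 := by
  rw [← hl]
  exact coeff_subst_gapRows (hT.comp (isLinearSubst_hyperplaneSubst S s₀))
    (coeff_comp_hyperplaneSubst_allBut hT hs₀ hdet) l E a

/-- The three families of functionals are the coefficients of the spikes of degree `n`, those of
`∏_{j ≠ s₀} x_j ^ (2 ^ d - 1)` after restriction to the hyperplanes given by the subsets `S`, and
those refining the latter in the leading rows of digits by a `TailSystem`. -/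
theorem numSpikes_add_le_finrank {k d n : ℕ} (hk : 3 ≤ k) (hd : 0 < d)
    (hn : n = (k - 1) * (2 ^ d - 1)) :
    numSpikes k n + ∑ t ∈ Finset.Icc 2 (min k d), k.choose t
        + (k - 3) * k.choose 2 * ∑ u ∈ Finset.Icc 2 (min k (d - 1)), k.choose u
      ≤ Module.finrank (ZMod 2) (QPdeg k n) := by
  classical
  obtain ⟨e, rfl⟩ : ∃ e, d = e + 1 := ⟨d - 1, by omega⟩
  rw [Nat.add_sub_cancel]
  have hthird : ∀ s a : Fin k, ∃ c, c ≠ s ∧ c ≠ a := fun s a => by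
    obtain ⟨c, -, hc⟩ := Finset.exists_mem_notMem_of_card_lt_card
      (s := {s, a}) (t := (Finset.univ : Finset (Fin k)))
      (by rw [Finset.card_univ, Fintype.card_fin]; exact lt_of_le_of_lt Finset.card_le_two hk)
    exact ⟨c, by simpa [not_or] using hc⟩
  choose b hb using hthird
  have hpt : ∀ S : Finset (Fin k), ∃ s, 2 ≤ S.card → s ∈ S := fun S => by
    by_cases h : 2 ≤ S.card
    · obtain ⟨s, hs⟩ := Finset.card_pos.1 (by omega : 0 < S.card)
      exact ⟨s, fun _ => hs⟩
    · exact ⟨⟨0, by omega⟩, fun h' => absurd h' h⟩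
  choose pt hpt using hpt
  have hword : ∀ (r : ℕ) (S : Finset (Fin k)), ∃ l : List (Fin k),
      2 ≤ S.card → S.card ≤ r → l.length = r ∧ l.toFinset = S := fun r S => by
    by_cases h : 2 ≤ S.card ∧ S.card ≤ r
    · obtain ⟨l, hl⟩ := exists_list_of_card_le (Finset.card_pos.1 (by omega)) h.2
      exact ⟨l, fun _ _ => hl⟩
    · exact ⟨[], fun h1 h2 => absurd ⟨h1, h2⟩ h⟩
  choose word hword using hword
  let I₁ := {a : Fin k →₀ ℕ // IsSpike a ∧ a.degree = n}
  let I₂ := {S : Finset (Fin k) // 2 ≤ S.card ∧ S.card ≤ min k (e + 1)}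
  let I₃ := Σ S : {S : Finset (Fin k) // 2 ≤ S.card ∧ S.card ≤ min k e},
    (spikeTails (pt S) ⊕ squareTails (pt S) (b (pt S)))
  have hfin : Finite I₁ :=
    ((Finsupp.finite_of_degree_eq (σ := Fin k) n).subset fun a ha => ha.2).to_subtype
  let _ : Fintype I₁ := Fintype.ofFinite I₁
  have hcard : Fintype.card (I₁ ⊕ I₂ ⊕ I₃) = numSpikes k n
      + ∑ t ∈ Finset.Icc 2 (min k (e + 1)), k.choose t
      + (k - 3) * k.choose 2 * ∑ u ∈ Finset.Icc 2 (min k e), k.choose u := by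
    have h₁ : Fintype.card I₁ = numSpikes k n := by
      rw [← Nat.card_eq_fintype_card]
      rfl
    have h₃ : Fintype.card I₃ =
        (k - 3) * k.choose 2 * ∑ u ∈ Finset.Icc 2 (min k e), k.choose u := by
      rw [Fintype.card_sigma, Finset.sum_const_nat (m := (k - 3) * k.choose 2), Finset.card_univ,
        card_subtype_card_mem_Icc, mul_comm]
      intro S _
      rw [Fintype.card_sum, Fintype.card_coe, Fintype.card_coe, card_tails hk (hb _)]
    rw [Fintype.card_sum, Fintype.card_sum, h₁, h₃, card_subtype_card_mem_Icc, add_assoc]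
  let sys : ∀ s₀ : Fin k, TailSystem s₀ (spikeTails s₀ ⊕ squareTails s₀ (b s₀)) :=
    fun s₀ => tailSystem s₀ (hb s₀)
  rw [← hcard]
  have hw₂ : ∀ S : I₂, (word (e + 1) S.1).length = e + 1 ∧ (word (e + 1) S.1).toFinset = S.1 :=
    fun S => hword (e + 1) S.1 S.2.1 (S.2.2.trans (min_le_right _ _))
  have hw₃ : ∀ x : I₃, (word e x.1.1).length = e ∧ (word e x.1.1).toFinset = x.1.1 :=
    fun x => hword e x.1.1 x.1.2.1 (x.1.2.2.trans (min_le_right _ _))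
  have hpt₂ : ∀ S : I₂, pt S.1 ∈ S.1 := fun S => hpt S.1 S.2.1
  have hpt₃ : ∀ x : I₃, pt x.1.1 ∈ x.1.1 := fun x => hpt x.1.1 x.1.2.1
  have hid : ∀ s₀ : Fin k,
      coeff (allBut s₀) (AlgHom.id (ZMod 2) (PolyAlg k) (monomial (allBut s₀) 1)) = 1 := by simp
  have hspike : ∀ (a : I₁) (l : List (Fin k)) (c : Fin k →₀ ℕ), 2 ≤ l.toFinset.card →
      coeff a.1 (monomial (gapRows l c) (1 : ZMod 2)) = 0 := by
    intro a l c hl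
    rw [coeff_monomial, if_neg]
    intro h
    have := card_toFinset_le_one_of_isSpike_gapRows (h ▸ a.2.1 : IsSpike (gapRows l c))
    omega
  refine card_le_finrank_QPdeg
    (L := Sum.elim (fun _ => AlgHom.id _ _) (Sum.elim
      (fun S => (AlgHom.id _ _).comp (hyperplaneSubst S.1 (pt S.1)))
      fun x => ((sys _).T x.2).comp (hyperplaneSubst x.1.1 (pt x.1.1))))
    (s := Sum.elim Subtype.val (Sum.elim
      (fun S => gapRows (List.replicate (e + 1) (pt S.1)) 0)
      fun x => gapRows (List.replicate e (pt x.1.1)) ((sys _).E x.2)))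
    (a := Sum.elim Subtype.val (Sum.elim
      (fun S => gapRows (word (e + 1) S.1) 0)
      fun x => gapRows (word e x.1.1) ((sys _).A x.2)))
    (rank := Sum.elim (fun _ => 0) (Sum.elim (fun S => 1 + S.1.card)
      fun x => k + 2 + 2 * x.1.1.card + (sys _).rank x.2))
    ?_ ?_ ?_ ?_ ?_
  · rintro (a | S | x)
    · exact isLinearSubst_id k
    · exact (isLinearSubst_id k).comp (isLinearSubst_hyperplaneSubst _ _)
    · exact ((sys _).isLinearSubst _).comp (isLinearSubst_hyperplaneSubst _ _)
  · rintro (a | S | x)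
    · exact a.2.1
    · exact (isSpike_gapRows_replicate (fun j => ⟨0, by simp⟩) (by simp) _).1
    · exact (isSpike_gapRows_replicate ((sys _).isSpike _) ((sys _).E_apply _) _).1
  · have hpow : ∀ r : ℕ, 1 ≤ 2 ^ r := fun r => Nat.one_le_two_pow
    have hn' : n + (k - 1) = 2 ^ (e + 1) * (k - 1) := by
      rw [hn]
      obtain ⟨m, hm⟩ := Nat.exists_eq_add_of_le (hpow (e + 1))
      rw [hm, Nat.add_sub_cancel_left]
      ring
    rintro (a | S | x)
    · exact a.2.2
    · have h := degree_gapRows (word (e + 1) S.1) 0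
      rw [(hw₂ S).1, map_zero, zero_add] at h
      simp only [Sum.elim_inl, Sum.elim_inr]
      omega
    · have h := degree_gapRows (word e x.1.1) ((sys _).A x.2)
      rw [(hw₃ x).1, (sys _).degree_A, ← two_mul, ← mul_assoc, ← pow_succ] at h
      simp only [Sum.elim_inr]
      omega
  · rintro (a | S | x)
    · simp
    · simp only [Sum.elim_inl, Sum.elim_inr]
      rw [coeff_comp_hyperplaneSubst_gapRows (isLinearSubst_id k) (hpt₂ S) (hid _) (hw₂ S).1,
        (hw₂ S).2, if_pos subset_rfl]
      simp
    · simp only [Sum.elim_inr]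
      rw [coeff_comp_hyperplaneSubst_gapRows ((sys _).isLinearSubst _) (hpt₃ x) ((sys _).det _)
        (hw₃ x).1, (hw₃ x).2, if_pos subset_rfl, AlgHom.comp_apply,
        hyperplaneSubst_monomial _ ((sys _).A_apply _), (sys _).diag]
  · rintro (a | S | x) (a' | S' | x') hne hrank
    · simp only [Sum.elim_inl, AlgHom.id_apply]
      rw [coeff_monomial, if_neg]
      intro h
      exact hne (congrArg Sum.inl (Subtype.ext h.symm))
    · exact hspike _ _ _ (by rw [(hw₂ S').2]; exact S'.2.1)
    · exact hspike _ _ _ (by rw [(hw₃ x').2]; exact x'.1.2.1)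
    · simp at hrank
    · simp only [Sum.elim_inl, Sum.elim_inr] at hrank ⊢
      rw [coeff_comp_hyperplaneSubst_gapRows (isLinearSubst_id k) (hpt₂ S) (hid _) (hw₂ S').1,
        (hw₂ S').2, if_neg]
      intro hsub
      apply hne
      have := Finset.eq_of_subset_of_card_le hsub (by omega)
      rw [Subtype.ext this]
    · -- Above the `e` lowest rows the spike is squarefree, while the monomial is divisible by `x_c²`.
      simp only [Sum.elim_inl, Sum.elim_inr]
      obtain ⟨c, hc⟩ := (sys _).two_le x'.2
      have hrow : gapRows [pt S.1] 0 = allBut (pt S.1) := by simp [gapRows]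
      rw [List.replicate_succ', gapRows_append, hrow,
        coeff_comp_hyperplaneSubst_gapRows (isLinearSubst_id k) (hpt₂ S) (hid _) (hw₃ x').1,
        ((isLinearSubst_id k).comp (isLinearSubst_hyperplaneSubst _ _)).coeff_squarefree_of_two_le
          (allBut_le_one _) hc, ite_self]
    · simp at hrank
    · simp only [Sum.elim_inl, Sum.elim_inr] at hrank
      have := S'.2.2.trans (min_le_left _ _)
      omega
    · obtain ⟨S, i⟩ := x
      obtain ⟨S', i'⟩ := x'
      by_cases hS : S = S'
      · subst hS
        simp only [Sum.elim_inr] at hrank ⊢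
        rw [coeff_comp_hyperplaneSubst_gapRows ((sys _).isLinearSubst _) (hpt S.1 S.2.1)
          ((sys _).det _) (hw₃ ⟨S, i'⟩).1, (hw₃ ⟨S, i'⟩).2, if_pos subset_rfl, AlgHom.comp_apply,
          hyperplaneSubst_monomial _ ((sys _).A_apply _), (sys _).off i i']
        · rintro rfl
          exact hne rfl
        · omega
      · simp only [Sum.elim_inr] at hrank ⊢
        rw [coeff_comp_hyperplaneSubst_gapRows ((sys _).isLinearSubst _) (hpt S.1 S.2.1)
          ((sys _).det _) (hw₃ ⟨S', i'⟩).1, (hw₃ ⟨S', i'⟩).2, if_neg]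
        intro hsub
        have hlt : S'.1.card < S.1.card := Finset.card_lt_card
          (hsub.ssubset_of_ne fun h => hS (Subtype.ext h.symm))
        have := (sys _).rank_le i'
        omega

theorem mainTheorem5 (k d n p q : ℕ) (hk : 3 ≤ k) (hd : 0 < d)
    (hn : n = (k - 1) * (2 ^ d - 1)) (hp : p = min k d) (hq : q = min k (d - 1)) :
    numSpikes k n + ∑ t ∈ Finset.Icc 2 p, k.choose t
        + (k - 3) * k.choose 2 * ∑ u ∈ Finset.Icc 2 q, k.choose u
      ≤ Module.finrank (ZMod 2) (QPdeg k n) ∧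
    numSpikes k n + ∑ t ∈ Finset.Icc 2 p, k.choose t
      ≤ Module.finrank (ZMod 2) (QPdeg k n) := by
  subst hp hq
  have h := numSpikes_add_le_finrank hk hd hn
  exact ⟨h, le_trans (Nat.le_add_right _ _) h⟩
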